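/- Let $\{X_j(t),\ t\in[0,1]\}$, $j=1,2,\dots$, be mutually uncorrelated (jointly measurable) zero-mean, square-integrable real random processes on one probability space, all with the same continuous covariance function $\mathcal K(t,s)$, $t,s\in[0,1]$. For $d\in\mathbb N=\{1,2,\dots\}$ and $t\in[0,1]^d$ put $$Y_d(t)=\sum_{j=1}^d X_j(t_j),\qquad Z_d(t)=Y_d(t)-\int_{[0,1]^d}Y_d(s)\,ds .$$ Let $\langle\cdot,\cdot\rangle_{2,d}$ and $\|\cdot\|_{2,d}$ be the scalar product and the norm of $L_2([0,1]^d)$. For a random field $V$ on $[0,1]^d$ with $\mathbb E\|V\|_{2,d}^2<\infty$ put $e^V(0)=(\mathbb E\|V\|_{2,d}^2)^{1/2}$ and, for $n\in\mathbb N$, $$e^V(n)=\inf\Bigl\{\Bigl(\mathbb E\Bigl\|V-\sum_{m=1}^n\langle V,\psi_m\rangle_{2,d}\,\psi_m\Bigr\|_{2,d}^2\Bigr)^{1/2}:\ \psi_1,\dots,\psi_n\in L_2([0,1]^d)\Bigr\},$$ and, for $\varepsilon>0$, let $$n^V(\varepsilon)=\min\{n\in\mathbb N:\ e^V(n)\le\varepsilon\,e^V(0)\}$$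 be the average case approximation complexity. Let $\Lambda$ be the trace of the covariance operator $f\mapsto\int_{[0,1]}\mathcal K(\cdot,s)f(s)\,ds$ on $L_2([0,1])$, let $$\bar\Lambda=\int_{[0,1]}\mathcal K(s,s)\,ds-\iint_{[0,1]^2}\mathcal K(t,s)\,dt\,ds ,$$ and suppose that $\bar\Lambda\neq0$ (then $\Lambda>0$). Put $\varepsilon_0=(\bar\Lambda/\Lambda)^{1/2}$. Then for every $\varepsilon\in(0,\varepsilon_0)$ and every $d\in\mathbb N$ the minima below exist and $$n^{Z_d}\bigl(\varepsilon/\varepsilon_0+d^{-1/2}\bigr)-1\ \le\ n^{Y_d}(\varepsilon)\ \le\ n^{Z_d}\bigl(\varepsilon/\varepsilon_0\bigr)+1 .$$ -/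

import Mathlib

open MeasureTheory ProbabilityTheory
open scoped ENNReal

namespace AdditiveField

noncomputable section

/-- The unit cube `[0,1]^d`, carrying Lebesgue measure (its `volume`). -/
abbrev Cube (d : ℕ) : Type := Fin d → unitInterval

/-- `(E ‖V‖²_{2,d})^{1/2}` for a random field `V` on `[0,1]^d`, as an extended non-negative real. -/
def rms {Ω : Type*} [MeasurableSpace Ω] (P : Measure Ω) {d : ℕ} (V : Ω → Cube d → ℝ) : ℝ≥0∞ :=
  (∫⁻ ω, eLpNorm (V ω) 2 volume ^ 2 ∂P) ^ (1 / 2 : ℝ)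

/-- The field `∑_{m=1}^n ⟨V, ψ_m⟩_{2,d} ψ_m` of rank at most `n`. -/
def rankApprox {Ω : Type*} {d n : ℕ} (V : Ω → Cube d → ℝ)
    (ψ : Fin n → Lp ℝ 2 (volume : Measure (Cube d))) : Ω → Cube d → ℝ :=
  fun ω t => ∑ m, (∫ s, V ω s * ψ m s) * ψ m t

/-- The smallest 2-average error `e^V(n)` among the approximations
`∑_{m=1}^n ⟨V, ψ_m⟩_{2,d} ψ_m`, with arbitrary `ψ_1, …, ψ_n ∈ L_2([0,1]^d)`. -/
def minError {Ω : Type*} [MeasurableSpace Ω] (P : Measure Ω) {d : ℕ} (V : Ω → Cube d → ℝ)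
    (n : ℕ) : ℝ≥0∞ :=
  ⨅ ψ : Fin n → Lp ℝ 2 (volume : Measure (Cube d)),
    rms P (fun ω t => V ω t - rankApprox V ψ ω t)

/-- The positive integers `n` with `e^V(n) ≤ ε e^V(0)`, where `e^V(0) = (E ‖V‖²_{2,d})^{1/2}`. -/
def admissibleRanks {Ω : Type*} [MeasurableSpace Ω] (P : Measure Ω) {d : ℕ}
    (V : Ω → Cube d → ℝ) (ε : ℝ) : Set ℕ :=
  {n | 1 ≤ n ∧ minError P V n ≤ ENNReal.ofReal ε * rms P V}

/-- The average case approximation complexity `n^V(ε)`: the least admissible rank. -/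
def complexity {Ω : Type*} [MeasurableSpace Ω] (P : Measure Ω) {d : ℕ}
    (V : Ω → Cube d → ℝ) (ε : ℝ) : ℕ :=
  sInf (admissibleRanks P V ε)

/-- The additive field `Y_d(t) = ∑_j X_j(t_j)`; the processes are numbered from `0`. -/
def fieldY {Ω : Type*} (X : ℕ → unitInterval → Ω → ℝ) (d : ℕ) : Ω → Cube d → ℝ :=
  fun ω t => ∑ j : Fin d, X j (t j) ω

/-- The centred field `Z_d(t) = Y_d(t) - ∫_{[0,1]^d} Y_d(s) ds`. -/
def fieldZ {Ω : Type*} (X : ℕ → unitInterval → Ω → ℝ) (d : ℕ) : Ω → Cube d → ℝ :=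
  fun ω t => fieldY X d ω t - ∫ s, fieldY X d ω s

/-- The integral operator `(K f)(t) = ∫_{[0,1]} K(t,s) f(s) ds`. -/
def covOp (K : unitInterval → unitInterval → ℝ) (f : unitInterval → ℝ) : unitInterval → ℝ :=
  fun t => ∫ s, K t s * f s

/-- The trace `Λ = ∑_i ⟨K e_i, e_i⟩` of the covariance operator, computed in an orthonormal basis
`(e_i)` of `L_2([0,1])`. In a basis of eigenvectors this is the sum of the eigenvalues. -/
def trace {ι : Type*} (K : unitInterval → unitInterval → ℝ)
    (e : HilbertBasis ι ℝ (Lp ℝ 2 (volume : Measure unitInterval))) : ℝ :=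
  ∑' i, ∫ t, covOp K (e i) t * e i t

/-- `Λ̄ = ∫ K(s,s) ds - ∬ K(t,s) dt ds`. -/
def traceBar (K : unitInterval → unitInterval → ℝ) : ℝ :=
  (∫ s, K s s) - ∫ t, ∫ s, K t s

/-- `ε₀ = (Λ̄ / Λ)^{1/2}`. -/
def epsZero {ι : Type*} (K : unitInterval → unitInterval → ℝ)
    (e : HilbertBasis ι ℝ (Lp ℝ 2 (volume : Measure unitInterval))) : ℝ :=
  Real.sqrt (traceBar K / trace K e)

end

end AdditiveField

/-! `Y_d` and `Z_d` differ by a random multiple of the fixed function `1`. If `ψ_1, …, ψ_n`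
approximate one of the fields, the orthogonal projection onto the span of `1, ψ_1, …, ψ_n`
approximates the other at least as well for every `ω`. So each field's error at rank `n + 1` is at
most the other's at rank `n` (`minError_succ_le`).

The two relative thresholds are the same absolute one. The second-moment kernel of `Y_d` is `∑
K(t_j, s_j)`, so `E‖Y_d‖² = dΛ` and, after subtracting `E(∫ Y_d)²`, `E‖Z_d‖² = dΛ̄`. Hence `ε e^Y(0)
= (ε/ε₀) e^Z(0)`. Here `Λ = ∫ K(s,s) ds` is Parseval's identity in mean square
(`trace_eq_integral`).

Thus the complexities at `ε` and `ε/ε₀` differ by at most one; the summand `d^{-1/2}` only weakens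
the lower bound. The minima exist because truncated basis expansions have arbitrarily small error
(`exists_minError_le`). -/

namespace AdditiveField

/-! ### Finite-rank approximation in a Hilbert space -/

section Hilbert

variable {H : Type*} [NormedAddCommGroup H] [InnerProductSpace ℝ H]

/-- The projection on a subspace of dimension at most `n` is of the form `x ↦ ∑ ⟪φ m, x⟫ φ m`
with `n` vectors. -/
lemma exists_sum_inner_smul_eq_starProjection (W : Submodule ℝ H) [FiniteDimensional ℝ W] {n : ℕ}
    (hW : Module.finrank ℝ W ≤ n) :
    ∃ φ : Fin n → H, ∀ x, ∑ m, inner ℝ (φ m) x • φ m = W.starProjection x := by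
  let b := stdOrthonormalBasis ℝ W
  -- An orthonormal basis of `W`, padded with zero vectors up to length `n`.
  refine ⟨fun m => if h : m.1 < Module.finrank ℝ W then (b ⟨m.1, h⟩ : H) else 0, fun x => ?_⟩
  have h1 : W.starProjection x = ∑ i, inner ℝ (b i : H) x • (b i : H) := by
    rw [Submodule.starProjection_apply, ← b.sum_repr' (W.orthogonalProjectionOnto x)]
    simp only [Submodule.coe_sum, Submodule.coe_smul,
      Submodule.inner_orthogonalProjectionOnto_eq_of_mem_left]
  rw [h1]
  symm
  refine Finset.sum_of_injOn (Fin.castLE hW) (Fin.castLE_injective hW).injOn (by simp) ?_ ?_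
  · intro i _ hi
    have : ¬ i.1 < Module.finrank ℝ W := fun h => hi ⟨⟨i.1, h⟩, by simp, rfl⟩
    simp [this]
  · intro i _
    simp

/-- Adjoining one more vector `u` to a finite-rank approximation allows to approximate every
translate along `u` at least as well. -/
lemma exists_norm_sub_sum_le {n : ℕ} (ψ : Fin n → H) (u : H) :
    ∃ φ : Fin (n + 1) → H, ∀ (x : H) (c : ℝ),
      ‖x + c • u - ∑ m, inner ℝ (φ m) (x + c • u) • φ m‖
        ≤ ‖x - ∑ m, inner ℝ (ψ m) x • ψ m‖ := by
  let W := Submodule.span ℝ (Set.range (Fin.cons u ψ : Fin (n + 1) → H))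
  have hW : Module.finrank ℝ W ≤ n + 1 := by
    have h := finrank_range_le_card (R := ℝ) (Fin.cons u ψ : Fin (n + 1) → H)
    rwa [Fintype.card_fin] at h
  have : FiniteDimensional ℝ W := FiniteDimensional.span_of_finite ℝ (Set.finite_range _)
  obtain ⟨φ, hφ⟩ := exists_sum_inner_smul_eq_starProjection W hW
  refine ⟨φ, fun x c => ?_⟩
  rw [hφ, Submodule.starProjection_minimal]
  have hu : u ∈ W := Submodule.subset_span ⟨0, by simp⟩
  have hψ : ∀ m, ψ m ∈ W := fun m => Submodule.subset_span ⟨m.succ, by simp⟩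
  -- The competitor in `W` whose distance to `x + c • u` is exactly the old error at `x`.
  have hw : c • u + ∑ m, inner ℝ (ψ m) x • ψ m ∈ W :=
    W.add_mem (W.smul_mem _ hu) (W.sum_mem fun m _ => W.smul_mem _ (hψ m))
  refine (ciInf_le ⟨0, by rintro _ ⟨w, rfl⟩; positivity⟩ (⟨_, hw⟩ : W)).trans_eq ?_
  change ‖x + c • u - (c • u + _)‖ = _
  congr 1
  abel

lemma norm_sub_sum_inner_smul_sq {ι : Type*} [Fintype ι] {b : ι → H} (hb : Orthonormal ℝ b)
    (x : H) : ‖x - ∑ i, inner ℝ (b i) x • b i‖ ^ 2 = ‖x‖ ^ 2 - ∑ i, inner ℝ (b i) x ^ 2 := by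
  rw [norm_sub_sq_real, inner_sum, ← real_inner_self_eq_norm_sq (∑ i, _), hb.inner_sum]
  simp only [inner_smul_right, real_inner_comm x, conj_trivial]
  simp only [← sq]
  ring

/-- Orthonormal vectors are `√2` apart, so the balls of radius `1/2` around them are disjoint.
Countability allows a basis expansion to be integrated term by term. -/
lemma _root_.Orthonormal.countable [TopologicalSpace.SeparableSpace H] {ι : Type*} {b : ι → H}
    (hb : Orthonormal ℝ b) : Countable ι := by
  refine Pairwise.countable_of_isOpen_disjoint (s := fun i => Metric.ball (b i) (1 / 2)) ?_
    (fun _ => Metric.isOpen_ball) fun i => ⟨b i, by simp⟩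
  intro i j hij
  refine Metric.ball_disjoint_ball ?_
  have h : ‖b i - b j‖ ^ 2 = 2 := by
    rw [norm_sub_sq_real, hb.1, hb.1, hb.2 hij]; norm_num
  rw [dist_eq_norm]
  nlinarith [norm_nonneg (b i - b j)]

end Hilbert

/-! ### Translation between integrals and the Hilbert space `L_2` -/

section L2

variable {α : Type*} [MeasurableSpace α] {μ : Measure α}

lemma inner_toLp {f : α → ℝ} (hf : MemLp f 2 μ) (g : Lp ℝ 2 μ) :
    inner ℝ g (hf.toLp f) = ∫ t, f t * g t ∂μ := by
  rw [L2.inner_def]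
  refine integral_congr_ae ?_
  filter_upwards [hf.coeFn_toLp] with t ht
  simp [ht]

lemma norm_toLp_sq {f : α → ℝ} (hf : MemLp f 2 μ) : ‖hf.toLp f‖ ^ 2 = ∫ t, f t ^ 2 ∂μ := by
  rw [← real_inner_self_eq_norm_sq, inner_toLp]
  refine integral_congr_ae ?_
  filter_upwards [hf.coeFn_toLp] with t ht
  simp [ht, sq]

lemma eLpNorm_two_sq {f : α → ℝ} (hf : MemLp f 2 μ) :
    eLpNorm f 2 μ ^ 2 = ENNReal.ofReal (∫ t, f t ^ 2 ∂μ) := by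
  rw [← norm_toLp_sq hf, Lp.norm_toLp, ENNReal.ofReal_pow ENNReal.toReal_nonneg,
    ENNReal.ofReal_toReal hf.2.ne]

lemma eLpNorm_sub_sum_mul {f : α → ℝ} (hf : MemLp f 2 μ) {n : ℕ} (ψ : Fin n → Lp ℝ 2 μ) :
    eLpNorm (fun t => f t - ∑ m, (∫ s, f s * ψ m s ∂μ) * ψ m t) 2 μ
      = ‖hf.toLp f - ∑ m, inner ℝ (ψ m) (hf.toLp f) • ψ m‖ₑ := by
  rw [Lp.enorm_def]
  refine eLpNorm_congr_ae ?_
  have h2 : ∀ᵐ t ∂μ, ∀ m, (inner ℝ (ψ m) (hf.toLp f) • ψ m : Lp ℝ 2 μ) t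
      = inner ℝ (ψ m) (hf.toLp f) * ψ m t := by
    rw [ae_all_iff]
    intro m
    filter_upwards [Lp.coeFn_smul (inner ℝ (ψ m) (hf.toLp f)) (ψ m)] with t ht
    simp [ht]
  filter_upwards [hf.coeFn_toLp, Lp.coeFn_sub (hf.toLp f) (∑ m, inner ℝ (ψ m) (hf.toLp f) • ψ m),
    h2, Lp.coeFn_finsetSum Finset.univ (fun m => inner ℝ (ψ m) (hf.toLp f) • ψ m)] with t h0 h1 h2 h3
  rw [h1, Pi.sub_apply, h0, h3, Finset.sum_apply]
  simp only [h2]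
  simp only [inner_toLp]

end L2

/-! ### Effect of a random constant on the minimal error -/

section Field

variable {Ω : Type*} [MeasurableSpace Ω] {P : Measure Ω}

/-- The constant function `1` is adjoined to `ψ`. The new vectors `φ` do not depend on the
coefficient `c ω`, so one choice serves all `ω`. -/
lemma minError_succ_le {d : ℕ} {V W : Ω → Cube d → ℝ} (hV : ∀ᵐ ω ∂P, MemLp (V ω) 2 volume)
    (c : Ω → ℝ) (hW : ∀ ω t, W ω t = V ω t + c ω) (n : ℕ) :
    minError P W (n + 1) ≤ minError P V n := by
  refine le_iInf fun ψ => ?_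
  have h1 : MemLp (fun _ : Cube d => (1 : ℝ)) 2 volume := memLp_const 1
  obtain ⟨φ, hφ⟩ := exists_norm_sub_sum_le ψ (h1.toLp _)
  refine (iInf_le _ φ).trans ?_
  refine ENNReal.rpow_le_rpow (lintegral_mono_ae ?_) (by norm_num)
  filter_upwards [hV] with ω hω
  gcongr 1
  have hcW : W ω = V ω + c ω • fun _ : Cube d => (1 : ℝ) := by
    ext t; simp [hW]
  have hW' : MemLp (W ω) 2 volume := by
    rw [hcW]; exact hω.add (h1.const_smul _)
  have hto : hW'.toLp (W ω) = hω.toLp (V ω) + c ω • h1.toLp _ := by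
    rw [← MemLp.toLp_const_smul, ← MemLp.toLp_add]
    congr 1
  have := hφ (hω.toLp _) (c ω)
  simp only [rankApprox]
  rw [eLpNorm_sub_sum_mul hW', eLpNorm_sub_sum_mul hω, hto]
  exact enorm_le_iff_norm_le.2 this

end Field

/-! ### Second moments of square-integrable random fields -/

section SecondOrder

variable {Ω α : Type*} [MeasurableSpace Ω] [MeasurableSpace α] {P : Measure Ω} {μ : Measure α}

lemma aestronglyMeasurable_integral_mul [SFinite μ] {V : Ω → α → ℝ}
    (hV : MemLp (fun z : Ω × α => V z.1 z.2) 2 (P.prod μ)) {g : α → ℝ} (hg : MemLp g 2 μ) :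
    AEStronglyMeasurable (fun ω => ∫ t, V ω t * g t ∂μ) P :=
  AEStronglyMeasurable.integral_prod_right' (f := fun z : Ω × α => V z.1 z.2 * g z.2)
    (hV.1.mul hg.1.comp_snd)

variable [IsProbabilityMeasure P] [IsProbabilityMeasure μ] {V : Ω → α → ℝ}

lemma ae_memLp_of_memLp_prod (hV : MemLp (fun z : Ω × α => V z.1 z.2) 2 (P.prod μ)) :
    ∀ᵐ ω ∂P, MemLp (V ω) 2 μ := by
  filter_upwards [hV.1.prodMk_left, hV.integrable_sq.prod_right_ae] with ω h1 h2
  exact (memLp_two_iff_integrable_sq h1).2 h2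

lemma lintegral_eLpNorm_sq (hV : MemLp (fun z : Ω × α => V z.1 z.2) 2 (P.prod μ)) :
    ∫⁻ ω, eLpNorm (V ω) 2 μ ^ 2 ∂P = ENNReal.ofReal (∫ ω, ∫ t, V ω t ^ 2 ∂μ ∂P) := by
  rw [ofReal_integral_eq_lintegral_ofReal hV.integrable_sq.integral_prod_left
    (.of_forall fun ω => integral_nonneg fun t => sq_nonneg _)]
  refine lintegral_congr_ae ?_
  filter_upwards [ae_memLp_of_memLp_prod hV] with ω hω
  exact eLpNorm_two_sq hω

/-- The second moment of `⟨V, g⟩` is the quadratic form of the second-moment kernel at `g`. -/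
lemma integral_sq_integral_mul (hV : MemLp (fun z : Ω × α => V z.1 z.2) 2 (P.prod μ))
    {R : α → α → ℝ} (hR : ∀ t s, ∫ ω, V ω t * V ω s ∂P = R t s) {g : α → ℝ} (hg : MemLp g 2 μ) :
    ∫ ω, (∫ t, V ω t * g t ∂μ) ^ 2 ∂P = ∫ t, (∫ s, R t s * g s ∂μ) * g t ∂μ := by
  -- Fubini on `Ω × α × α` needs an integrable integrand: it is the product of `V(ω,t) g(s)` and
  -- `V(ω,s) g(t)`, both square integrable.
  have hA : MemLp (fun z : Ω × α × α => V z.1 z.2.1 * g z.2.2) 2 (P.prod (μ.prod μ)) := by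
    have h : MemLp (fun z : (Ω × α) × α => V z.1.1 z.1.2 * g z.2) 2 ((P.prod μ).prod μ) := by
      refine (memLp_two_iff_integrable_sq (hV.1.comp_fst.mul hg.1.comp_snd)).2 ?_
      refine (hV.integrable_sq.mul_prod hg.integrable_sq).congr (.of_forall fun z => ?_)
      exact (mul_pow _ _ _).symm
    exact h.comp_measurePreserving (measurePreserving_prodAssoc P μ μ).symm
  have hB : MemLp (fun z : Ω × α × α => V z.1 z.2.2 * g z.2.1) 2 (P.prod (μ.prod μ)) :=
    hA.comp_measurePreserving ((MeasurePreserving.id P).prod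
      (Measure.measurePreserving_swap (μ := μ) (ν := μ)))
  have hF : Integrable (fun z : Ω × α × α => V z.1 z.2.1 * g z.2.1 * (V z.1 z.2.2 * g z.2.2))
      (P.prod (μ.prod μ)) := by
    refine (hA.integrable_mul hB).congr (.of_forall fun z => ?_)
    simp only [Pi.mul_apply]
    ring
  calc ∫ ω, (∫ t, V ω t * g t ∂μ) ^ 2 ∂P
      = ∫ ω, ∫ z : α × α, V ω z.1 * g z.1 * (V ω z.2 * g z.2) ∂(μ.prod μ) ∂P := by
        refine integral_congr_ae (.of_forall fun ω => ?_)
        exact (sq _).trans (integral_prod_mul _ _).symm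
    _ = ∫ z : α × α, ∫ ω, V ω z.1 * g z.1 * (V ω z.2 * g z.2) ∂P ∂(μ.prod μ) :=
        integral_integral_swap hF
    _ = ∫ t, ∫ s, ∫ ω, V ω t * g t * (V ω s * g s) ∂P ∂μ ∂μ :=
        integral_prod _ hF.integral_prod_right
    _ = ∫ t, (∫ s, R t s * g s ∂μ) * g t ∂μ := by
        refine integral_congr_ae (.of_forall fun t => ?_)
        simp only
        rw [← integral_mul_const]
        refine integral_congr_ae (.of_forall fun s => ?_)
        simp only
        rw [← hR, mul_assoc, ← integral_mul_const]
        refine integral_congr_ae (.of_forall fun ω => ?_)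
        simp only
        ring

lemma integral_integral_sq (hV : MemLp (fun z : Ω × α => V z.1 z.2) 2 (P.prod μ))
    {R : α → α → ℝ} (hR : ∀ t s, ∫ ω, V ω t * V ω s ∂P = R t s) :
    ∫ ω, ∫ t, V ω t ^ 2 ∂μ ∂P = ∫ t, R t t ∂μ := by
  rw [integral_integral_swap (f := fun ω t => V ω t ^ 2) hV.integrable_sq]
  simp only [← hR, sq]

lemma hasSum_inner_sq {H ι : Type*} [NormedAddCommGroup H] [InnerProductSpace ℝ H]
    (b : HilbertBasis ι ℝ H) (x : H) : HasSum (fun i => inner ℝ (b i) x ^ 2) (‖x‖ ^ 2) := by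
  have := b.hasSum_inner_mul_inner x x
  rw [real_inner_self_eq_norm_sq] at this
  simpa only [real_inner_comm x, ← sq] using this

/-- Parseval's identity in mean square. -/
lemma hasSum_integral_sq_integral_mul [IsSeparable μ]
    (hV : MemLp (fun z : Ω × α => V z.1 z.2) 2 (P.prod μ)) {ι : Type*}
    (b : HilbertBasis ι ℝ (Lp ℝ 2 μ)) :
    HasSum (fun i => ∫ ω, (∫ t, V ω t * b i t ∂μ) ^ 2 ∂P) (∫ ω, ∫ t, V ω t ^ 2 ∂μ ∂P) := by
  have : Fact ((2 : ℝ≥0∞) ≠ ∞) := ⟨by norm_num⟩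
  have := b.orthonormal.countable
  have hs : ∀ᵐ ω ∂P, HasSum (fun i => (∫ t, V ω t * b i t ∂μ) ^ 2) (∫ t, V ω t ^ 2 ∂μ) := by
    filter_upwards [ae_memLp_of_memLp_prod hV] with ω hω
    have := hasSum_inner_sq b (hω.toLp _)
    simpa only [inner_toLp, norm_toLp_sq] using this
  refine hasSum_integral_of_dominated_convergence
    (fun i ω => (∫ t, V ω t * b i t ∂μ) ^ 2)
    (fun i => (aestronglyMeasurable_integral_mul hV (Lp.memLp (b i))).pow 2)
    (fun i => .of_forall fun ω => by simp) (hs.mono fun ω h => h.summable) ?_ hs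
  refine hV.integrable_sq.integral_prod_left.congr ?_
  filter_upwards [hs] with ω h
  exact h.tsum_eq.symm

lemma integrable_sq_integral_mul
    (hV : MemLp (fun z : Ω × α => V z.1 z.2) 2 (P.prod μ)) (b : Lp ℝ 2 μ) (hb : ‖b‖ = 1) :
    Integrable (fun ω => (∫ t, V ω t * b t ∂μ) ^ 2) P := by
  refine hV.integrable_sq.integral_prod_left.mono'
    ((aestronglyMeasurable_integral_mul hV (Lp.memLp b)).pow 2) ?_
  filter_upwards [ae_memLp_of_memLp_prod hV] with ω hω
  rw [Real.norm_of_nonneg (sq_nonneg _), ← inner_toLp hω b, ← norm_toLp_sq hω]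
  have := abs_real_inner_le_norm b (hω.toLp _)
  rw [hb, one_mul] at this
  rw [← sq_abs]
  gcongr

/-- Pythagoras for each `ω`, then expectation. -/
lemma lintegral_eLpNorm_sub_sum_sq
    (hV : MemLp (fun z : Ω × α => V z.1 z.2) 2 (P.prod μ)) {n : ℕ} {ψ : Fin n → Lp ℝ 2 μ}
    (hψ : Orthonormal ℝ ψ) :
    ∫⁻ ω, eLpNorm (fun t => V ω t - ∑ m, (∫ s, V ω s * ψ m s ∂μ) * ψ m t) 2 μ ^ 2 ∂P
      = ENNReal.ofReal (∫ ω, ∫ t, V ω t ^ 2 ∂μ ∂P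
          - ∑ m, ∫ ω, (∫ t, V ω t * ψ m t ∂μ) ^ 2 ∂P) := by
  have hint : ∀ m, Integrable (fun ω => (∫ t, V ω t * ψ m t ∂μ) ^ 2) P :=
    fun m => integrable_sq_integral_mul hV _ (hψ.1 m)
  have key : ∀ᵐ ω ∂P, ∀ h : MemLp (V ω) 2 μ,
      ‖h.toLp (V ω) - ∑ m, inner ℝ (ψ m) (h.toLp (V ω)) • ψ m‖ ^ 2
        = ∫ t, V ω t ^ 2 ∂μ - ∑ m, (∫ t, V ω t * ψ m t ∂μ) ^ 2 := by
    refine .of_forall fun ω h => ?_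
    rw [norm_sub_sum_inner_smul_sq hψ, norm_toLp_sq]
    simp only [inner_toLp]
  rw [← integral_finsetSum _ fun m _ => hint m, ← integral_sub hV.integrable_sq.integral_prod_left
    (integrable_finsetSum _ fun m _ => hint m), ofReal_integral_eq_lintegral_ofReal]
  · refine lintegral_congr_ae ?_
    filter_upwards [ae_memLp_of_memLp_prod hV, key] with ω hω h
    rw [eLpNorm_sub_sum_mul hω, ← h hω, ← ofReal_norm, ENNReal.ofReal_pow (norm_nonneg _)]
  · exact hV.integrable_sq.integral_prod_left.sub (integrable_finsetSum _ fun m _ => hint m)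
  · filter_upwards [ae_memLp_of_memLp_prod hV, key] with ω hω h
    simp only [Pi.zero_apply]
    rw [← h hω]
    positivity

lemma memLp_integral (hV : MemLp (fun z : Ω × α => V z.1 z.2) 2 (P.prod μ)) :
    MemLp (fun ω => ∫ s, V ω s ∂μ) 2 P := by
  have hm : AEStronglyMeasurable (fun ω => ∫ s, V ω s ∂μ) P := hV.1.integral_prod_right'
  refine (memLp_two_iff_integrable_sq hm).2 ?_
  refine hV.integrable_sq.integral_prod_left.mono' (hm.pow 2) ?_
  filter_upwards [ae_memLp_of_memLp_prod hV] with ω hω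
  rw [Real.norm_of_nonneg (sq_nonneg _)]
  -- Jensen's inequality `(∫ V)² ≤ ∫ V²`, read off from the variance of `V ω` under `μ`.
  have h := variance_nonneg (V ω) μ
  rw [variance_eq_sub hω] at h
  simpa using h

/-- For each `ω` this is the variance formula for `V ω` under the probability measure `μ`. -/
lemma integral_integral_sub_integral_sq (hV : MemLp (fun z : Ω × α => V z.1 z.2) 2 (P.prod μ)) :
    ∫ ω, ∫ t, (V ω t - ∫ s, V ω s ∂μ) ^ 2 ∂μ ∂P
      = ∫ ω, ∫ t, V ω t ^ 2 ∂μ ∂P - ∫ ω, (∫ s, V ω s ∂μ) ^ 2 ∂P := by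
  rw [← integral_sub hV.integrable_sq.integral_prod_left (memLp_integral hV).integrable_sq]
  refine integral_congr_ae ?_
  filter_upwards [ae_memLp_of_memLp_prod hV] with ω hω
  have h := variance_eq_sub hω
  rw [variance_eq_integral hω.1.aemeasurable] at h
  simpa using h

end SecondOrder

/-! ### Finite ranks achieve any accuracy -/

section Rank

variable {Ω : Type*} [MeasurableSpace Ω] {P : Measure Ω} [IsProbabilityMeasure P] {d : ℕ}
  {V : Ω → Cube d → ℝ}

lemma rms_eq_ofReal_sqrt (hV : MemLp (fun z : Ω × Cube d => V z.1 z.2) 2 (P.prod volume)) :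
    rms P V = ENNReal.ofReal (√(∫ ω, (∫ t, V ω t ^ 2) ∂P)) := by
  have h0 : 0 ≤ ∫ ω, (∫ t, V ω t ^ 2) ∂P :=
    integral_nonneg fun ω => integral_nonneg fun t => sq_nonneg _
  rw [rms, lintegral_eLpNorm_sq hV, ENNReal.ofReal_rpow_of_nonneg h0 (by norm_num),
    Real.sqrt_eq_rpow]

/-- By Parseval in mean square, finitely many basis vectors capture all but `δ²` of `E‖V‖²`. -/
lemma exists_minError_le (hV : MemLp (fun z : Ω × Cube d => V z.1 z.2) 2 (P.prod volume))
    {δ : ℝ} (hδ : 0 < δ) : ∃ n, minError P V n ≤ ENNReal.ofReal δ := by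
  obtain ⟨w, b, -⟩ := exists_hilbertBasis ℝ (Lp ℝ 2 (volume : Measure (Cube d)))
  have : MeasurableSpace.CountablyGenerated (Cube d) := countablyGenerated_of_standardBorel
  have hs := hasSum_integral_sq_integral_mul hV b
  obtain ⟨F, hF⟩ := (hs.eventually (lt_mem_nhds (sub_lt_self _ (pow_pos hδ 2)))).exists
  let ψ : Fin F.card → Lp ℝ 2 (volume : Measure (Cube d)) := fun m => b (F.equivFin.symm m)
  have hψ : Orthonormal ℝ ψ :=
    b.orthonormal.comp _ (Subtype.val_injective.comp F.equivFin.symm.injective)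
  have hsum : ∑ m, ∫ ω, (∫ t, V ω t * ψ m t) ^ 2 ∂P = ∑ i ∈ F, ∫ ω, (∫ t, V ω t * b i t) ^ 2 ∂P := by
    rw [← Finset.sum_coe_sort F]
    exact Equiv.sum_comp F.equivFin.symm (fun i : F => ∫ ω, (∫ t, V ω t * b i t) ^ 2 ∂P)
  refine ⟨F.card, (iInf_le _ ψ).trans ?_⟩
  simp only [rms, rankApprox]
  rw [lintegral_eLpNorm_sub_sum_sq hV hψ, hsum]
  calc _ ≤ ENNReal.ofReal (δ ^ 2) ^ (1 / 2 : ℝ) := by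
        gcongr
        linarith
    _ = ENNReal.ofReal δ := by
        rw [ENNReal.ofReal_rpow_of_nonneg (by positivity) (by norm_num), ← Real.sqrt_eq_rpow,
          Real.sqrt_sq hδ.le]

end Rank

/-! ### Moments of the additive fields and the trace -/

section Additive

variable {Ω : Type*} [MeasurableSpace Ω] {P : Measure Ω} [IsProbabilityMeasure P]
  {X : ℕ → unitInterval → Ω → ℝ} {K : unitInterval → unitInterval → ℝ}

lemma integral_mul_eq_covariance {f g : Ω → ℝ} (hf : MemLp f 2 P) (hg : MemLp g 2 P)
    (hf0 : ∫ ω, f ω ∂P = 0) : ∫ ω, f ω * g ω ∂P = covariance f g P := by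
  rw [covariance_eq_sub hf hg, hf0, zero_mul, sub_zero]
  rfl

/-- By Tonelli it suffices that `t ↦ E X_j(t)² = K(t,t)` is integrable; it is continuous on a
compact interval. -/
lemma memLp_process (hK : Continuous (Function.uncurry K))
    (hmeas : ∀ j, AEStronglyMeasurable (fun p : Ω × unitInterval => X j p.2 p.1) (P.prod volume))
    (hL2 : ∀ j t, MemLp (X j t) 2 P) (hmean : ∀ j t, ∫ ω, X j t ω ∂P = 0)
    (hcov : ∀ j t s, covariance (X j t) (X j s) P = K t s) (j : ℕ) :
    MemLp (fun p : Ω × unitInterval => X j p.2 p.1) 2 (P.prod volume) := by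
  refine (memLp_two_iff_integrable_sq (hmeas j)).2 ((integrable_prod_iff' ((hmeas j).pow 2)).2
    ⟨.of_forall fun t => (hL2 j t).integrable_sq, ?_⟩)
  have h : ∀ t, ∫ ω, ‖X j t ω ^ 2‖ ∂P = K t t := fun t => by
    rw [← hcov j, ← integral_mul_eq_covariance (hL2 j t) (hL2 j t) (hmean j t)]
    simp [← sq]
  simp only [Pi.pow_apply, h]
  have hc : Continuous fun t => K t t := hK.comp (continuous_id.prodMk continuous_id)
  exact hc.integrable_of_hasCompactSupport (HasCompactSupport.of_compactSpace _)

lemma memLp_fieldY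
    (hX : ∀ j, MemLp (fun p : Ω × unitInterval => X j p.2 p.1) 2 (P.prod volume)) (d : ℕ) :
    MemLp (fun z : Ω × Cube d => fieldY X d z.1 z.2) 2 (P.prod volume) := by
  refine memLp_finsetSum (f := fun (j : Fin d) (z : Ω × Cube d) => X j (z.2 j) z.1) _ fun j _ => ?_
  exact (hX j).comp_measurePreserving ((MeasurePreserving.id P).prod
    (measurePreserving_eval (fun _ : Fin d => (volume : Measure unitInterval)) j))

lemma memLp_fieldZ {d : ℕ}
    (hY : MemLp (fun z : Ω × Cube d => fieldY X d z.1 z.2) 2 (P.prod volume)) :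
    MemLp (fun z : Ω × Cube d => fieldZ X d z.1 z.2) 2 (P.prod volume) :=
  hY.sub ((memLp_integral hY).comp_fst volume)

lemma integral_fieldY_mul (hL2 : ∀ j t, MemLp (X j t) 2 P) (hmean : ∀ j t, ∫ ω, X j t ω ∂P = 0)
    (hcov : ∀ j t s, covariance (X j t) (X j s) P = K t s)
    (huncorr : ∀ j k, j ≠ k → ∀ t s, covariance (X j t) (X k s) P = 0) {d : ℕ} (t s : Cube d) :
    ∫ ω, fieldY X d ω t * fieldY X d ω s ∂P = ∑ j, K (t j) (s j) := by
  have hY : ∀ t : Cube d, MemLp (fun ω => fieldY X d ω t) 2 P := fun t =>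
    memLp_finsetSum (f := fun (j : Fin d) ω => X j (t j) ω) _ fun j _ => hL2 j (t j)
  have h0 : ∫ ω, fieldY X d ω t ∂P = 0 := by
    simp only [fieldY]
    rw [integral_finsetSum _ fun (j : Fin d) _ => (hL2 j (t j)).integrable (by norm_num)]
    simp [hmean]
  rw [integral_mul_eq_covariance (hY t) (hY s) h0]
  simp only [fieldY]
  rw [covariance_fun_sum_fun_sum (X := fun (j : Fin d) ω => X j (t j) ω)
    (Y := fun (j : Fin d) ω => X j (s j) ω) (fun j => hL2 j _) (fun j => hL2 j _)]
  refine Finset.sum_congr rfl fun j _ => ?_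
  rw [Finset.sum_eq_single j]
  · exact hcov _ _ _
  · exact fun k _ hk => huncorr _ _ (fun h => hk (Fin.ext h.symm)) _ _
  · simp

lemma integral_sum_eval {d : ℕ} {f : Fin d → unitInterval → ℝ} (hf : ∀ j, Continuous (f j)) :
    ∫ t : Cube d, ∑ j, f j (t j) = ∑ j, ∫ s, f j s := by
  have hmp := measurePreserving_eval (fun _ : Fin d => (volume : Measure unitInterval))
  have hint : ∀ j, Integrable (f j) := fun j =>
    (hf j).integrable_of_hasCompactSupport (HasCompactSupport.of_compactSpace _)
  have hcomp : ∀ j, Integrable fun t : Cube d => f j (t j) :=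
    fun j => (hmp j).integrable_comp_of_integrable (hint j)
  rw [integral_finsetSum _ fun j _ => hcomp j]
  refine Finset.sum_congr rfl fun j _ => ?_
  rw [← (hmp j).map_eq, integral_map (hmp j).measurable.aemeasurable (hf j).aestronglyMeasurable]
  rfl

lemma integral_fieldY_sq (hK : Continuous (Function.uncurry K))
    (hX : ∀ j, MemLp (fun p : Ω × unitInterval => X j p.2 p.1) 2 (P.prod volume))
    {d : ℕ} (hR : ∀ t s, ∫ ω, fieldY X d ω t * fieldY X d ω s ∂P = ∑ j, K (t j) (s j)) :
    ∫ ω, (∫ t, fieldY X d ω t ^ 2) ∂P = d * ∫ s, K s s := by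
  rw [integral_integral_sq (memLp_fieldY hX d) hR]
  rw [integral_sum_eval (f := fun _ t => K t t)
    fun _ => hK.comp (continuous_id.prodMk continuous_id)]
  simp

lemma integral_fieldZ_sq (hK : Continuous (Function.uncurry K))
    (hX : ∀ j, MemLp (fun p : Ω × unitInterval => X j p.2 p.1) 2 (P.prod volume))
    {d : ℕ} (hR : ∀ t s, ∫ ω, fieldY X d ω t * fieldY X d ω s ∂P = ∑ j, K (t j) (s j)) :
    ∫ ω, (∫ t, fieldZ X d ω t ^ 2) ∂P = d * traceBar K := by
  -- Taking `g = 1` gives `E(∫ Y_d)²` as the double integral of the kernel `∑ K(t_j, s_j)`, which is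
  -- `d ∬ K`.
  have h := integral_sq_integral_mul (memLp_fieldY hX d) hR
    (memLp_const (1 : ℝ) : MemLp (fun _ : Cube d => (1 : ℝ)) 2 volume)
  simp only [mul_one] at h
  have h1 : ∀ t : Cube d, ∫ s : Cube d, ∑ j, K (t j) (s j) = ∑ j, ∫ s, K (t j) s :=
    fun t => integral_sum_eval fun j => hK.comp (Continuous.prodMk_right _)
  have hc : Continuous fun t => ∫ s, K t s := by
    simpa using continuous_parametric_integral_of_continuous (μ := volume) (f := K) hK
      isCompact_univ
  simp only [h1] at h
  rw [integral_sum_eval (f := fun _ t => ∫ s, K t s) fun _ => hc, Finset.sum_const,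
    Finset.card_univ, Fintype.card_fin, nsmul_eq_mul] at h
  have h2 := integral_integral_sub_integral_sq (memLp_fieldY hX d)
  rw [h, integral_fieldY_sq hK hX hR, ← mul_sub] at h2
  exact h2

/-- Each diagonal term `⟨K e_i, e_i⟩` equals `E⟨X_0, e_i⟩²`, so Parseval sums them to `E‖X_0‖²`. No
eigenbasis is needed. -/
lemma trace_eq_integral
    (hX : ∀ j, MemLp (fun p : Ω × unitInterval => X j p.2 p.1) 2 (P.prod volume))
    (hR : ∀ t s, ∫ ω, X 0 t ω * X 0 s ω ∂P = K t s) {ι : Type*}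
    (e : HilbertBasis ι ℝ (Lp ℝ 2 (volume : Measure unitInterval))) :
    trace K e = ∫ s, K s s := by
  have h := hasSum_integral_sq_integral_mul (V := fun ω t => X 0 t ω) (hX 0) e
  rw [integral_integral_sq (V := fun ω t => X 0 t ω) (hX 0) hR] at h
  rw [trace, ← h.tsum_eq]
  refine tsum_congr fun i => ?_
  exact (integral_sq_integral_mul (V := fun ω t => X 0 t ω) (hX 0) hR (Lp.memLp (e i))).symm

end Additive

/-! ### Comparison of complexities -/

lemma admissibleRanks_mono {Ω : Type*} [MeasurableSpace Ω] {P : Measure Ω} {d : ℕ}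
    {V : Ω → Cube d → ℝ} {ε δ : ℝ} (h : ε ≤ δ) :
    admissibleRanks P V ε ⊆ admissibleRanks P V δ :=
  fun _ hn => ⟨hn.1, hn.2.trans (by gcongr)⟩

/-- Nonemptiness matters: the infimum of the empty set is `0`, which need not be admissible. -/
lemma complexity_le_add_one {Ω : Type*} [MeasurableSpace Ω] {P : Measure Ω} {d : ℕ}
    {V W : Ω → Cube d → ℝ} {ε δ : ℝ} (hV : (admissibleRanks P V ε).Nonempty)
    (h : ∀ n ∈ admissibleRanks P V ε, n + 1 ∈ admissibleRanks P W δ) :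
    complexity P W δ ≤ complexity P V ε + 1 :=
  Nat.sInf_le (h _ (Nat.sInf_mem hV))

end AdditiveField

open AdditiveField in
theorem theorem1 {Ω : Type*} [MeasurableSpace Ω] (P : Measure Ω) [IsProbabilityMeasure P]
    (X : ℕ → unitInterval → Ω → ℝ) (K : unitInterval → unitInterval → ℝ)
    (hK : Continuous (Function.uncurry K))
    (hmeas : ∀ j, AEStronglyMeasurable (fun p : Ω × unitInterval => X j p.2 p.1) (P.prod volume))
    (hL2 : ∀ j t, MemLp (X j t) 2 P)
    (hmean : ∀ j t, ∫ ω, X j t ω ∂P = 0)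
    (hcov : ∀ j t s, covariance (X j t) (X j s) P = K t s)
    (huncorr : ∀ j k, j ≠ k → ∀ t s, covariance (X j t) (X k s) P = 0)
    {ι : Type*} (e : HilbertBasis ι ℝ (Lp ℝ 2 (volume : Measure unitInterval)))
    (ε : ℝ) (hε : 0 < ε) (hε' : ε < AdditiveField.epsZero K e) (d : ℕ) (hd : 1 ≤ d) :
    -- the minima that define the three complexities exist
    (AdditiveField.admissibleRanks P (AdditiveField.fieldZ X d)
        (ε / AdditiveField.epsZero K e + (d : ℝ) ^ (-(1 / 2) : ℝ))).Nonempty ∧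
    (AdditiveField.admissibleRanks P (AdditiveField.fieldY X d) ε).Nonempty ∧
    (AdditiveField.admissibleRanks P (AdditiveField.fieldZ X d)
        (ε / AdditiveField.epsZero K e)).Nonempty ∧
    ((AdditiveField.complexity P (AdditiveField.fieldZ X d)
        (ε / AdditiveField.epsZero K e + (d : ℝ) ^ (-(1 / 2) : ℝ)) : ℤ) - 1
      ≤ AdditiveField.complexity P (AdditiveField.fieldY X d) ε) ∧
    (AdditiveField.complexity P (AdditiveField.fieldY X d) ε
      ≤ AdditiveField.complexity P (AdditiveField.fieldZ X d)
          (ε / AdditiveField.epsZero K e) + 1) := by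
  have hX := memLp_process hK hmeas hL2 hmean hcov
  have hR := integral_fieldY_mul hL2 hmean hcov huncorr (d := d)
  have hY := memLp_fieldY hX d
  have hZ := memLp_fieldZ hY
  have htr : trace K e = ∫ s, K s s := trace_eq_integral hX
    (fun t s => by rw [integral_mul_eq_covariance (hL2 0 t) (hL2 0 s) (hmean 0 t), hcov]) e
  have hA0 : 0 ≤ trace K e := htr ▸ integral_nonneg fun s => by
    rw [← hcov 0, covariance_self (hL2 0 s).1.aemeasurable]
    exact variance_nonneg _ _
  have he0 : 0 < epsZero K e := hε.trans hε'
  -- If `Λ = 0`, division by zero would give `ε₀ = 0`, contrary to `0 < ε < ε₀`.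
  have hA : 0 < trace K e := by
    refine hA0.lt_of_ne fun h => he0.ne' ?_
    rw [epsZero, ← h, div_zero, Real.sqrt_zero]
  have hdpos : (0 : ℝ) < d := by exact_mod_cast hd
  have hrY : rms P (fieldY X d) = ENNReal.ofReal √(d * trace K e) := by
    rw [rms_eq_ofReal_sqrt hY, integral_fieldY_sq hK hX hR, htr]
  have hrZ : rms P (fieldZ X d) = ENNReal.ofReal √(d * traceBar K) := by
    rw [rms_eq_ofReal_sqrt hZ, integral_fieldZ_sq hK hX hR]
  have hbar : traceBar K = epsZero K e ^ 2 * trace K e := by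
    rw [epsZero, Real.sq_sqrt (Real.sqrt_pos.1 he0).le, div_mul_cancel₀ _ hA.ne']
  -- Both sides are `ε √(dΛ)`, since `√(dΛ̄) = ε₀ √(dΛ)`.
  have heq : ENNReal.ofReal (ε / epsZero K e) * rms P (fieldZ X d)
      = ENNReal.ofReal ε * rms P (fieldY X d) := by
    rw [hrY, hrZ, hbar, ← ENNReal.ofReal_mul (by positivity), ← ENNReal.ofReal_mul hε.le,
      mul_left_comm, Real.sqrt_mul (sq_nonneg _), Real.sqrt_sq he0.le, ← mul_assoc,
      div_mul_cancel₀ _ he0.ne']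
  have hYZ : ∀ n, minError P (fieldZ X d) (n + 1) ≤ minError P (fieldY X d) n :=
    minError_succ_le (ae_memLp_of_memLp_prod hY) (fun ω => -∫ s, fieldY X d ω s)
      fun ω t => sub_eq_add_neg _ _
  have hZY : ∀ n, minError P (fieldY X d) (n + 1) ≤ minError P (fieldZ X d) n :=
    minError_succ_le (ae_memLp_of_memLp_prod hZ) (fun ω => ∫ s, fieldY X d ω s)
      fun ω t => (sub_add_cancel _ _).symm
  -- Only the error bound is required, not `1 ≤ n`, so that the rank from `exists_minError_le`,
  -- possibly `0`, can be used.
  have stepYZ : ∀ n, minError P (fieldY X d) n ≤ ENNReal.ofReal ε * rms P (fieldY X d) →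
      n + 1 ∈ admissibleRanks P (fieldZ X d) (ε / epsZero K e) :=
    fun n hn => ⟨by omega, (hYZ n).trans (hn.trans heq.ge)⟩
  have stepZY : ∀ n ∈ admissibleRanks P (fieldZ X d) (ε / epsZero K e),
      n + 1 ∈ admissibleRanks P (fieldY X d) ε :=
    fun n hn => ⟨by omega, (hZY n).trans (hn.2.trans heq.le)⟩
  obtain ⟨n, hn⟩ := exists_minError_le hY (δ := ε * √(d * trace K e)) (by positivity)
  rw [ENNReal.ofReal_mul hε.le, ← hrY] at hn
  have neZ : (admissibleRanks P (fieldZ X d) (ε / epsZero K e)).Nonempty := ⟨_, stepYZ n hn⟩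
  have neY : (admissibleRanks P (fieldY X d) ε).Nonempty := ⟨_, stepZY _ (stepYZ n hn)⟩
  -- The nonnegative summand `d^{-1/2}` enlarges the set of admissible ranks; nothing else about it
  -- is used.
  have hsub := admissibleRanks_mono (P := P) (V := fieldZ X d)
    (le_add_of_nonneg_right (Real.rpow_nonneg hdpos.le _) :
      ε / epsZero K e ≤ ε / epsZero K e + (d : ℝ) ^ (-(1 / 2) : ℝ))
  refine ⟨neZ.mono hsub, neY, neZ, ?_, complexity_le_add_one neZ stepZY⟩
  have := complexity_le_add_one neY fun n hn => hsub (stepYZ n hn.2)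
  omega
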